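/- For $\gamma\in(0,\pi)$ and $r>0$ let $\Omega_\gamma^r=\{z\in\mathbb C\setminus\{0\}: |z|<r,\ \arg z\in(-\gamma/2,\gamma/2)\}$, and write $\Omega_\gamma=\Omega_\gamma^1$. For every $\varepsilon>0$ there is $\delta=\delta(\varepsilon)\in(0,1/2)$, and for all $0<\alpha<\beta<\pi$ and every constant $C_F$ there is a finite constant $C=C(\varepsilon,\alpha,\beta,C_F)$, such that the following holds. If $F$ is analytic in $\Omega_\alpha^{1/2}$ and $|F'(z)|\le C_F/|z|$ for all $z\in\Omega_\alpha^{1/2}$, then there is a real-valued harmonic function $u$ in $\Omega_\beta$ such that 1) $|u(x)-\operatorname{Re}F(x)|\le\varepsilon$ for all $x\in(0,\delta(\varepsilon)]$; 2) the harmonic conjugate $\tilde u$ of $u$ in $\Omega_\beta$ normalized by $\tilde u(1/2)=0$ satisfies $|\tilde u(z)|\le C(\varepsilon,\alpha,\beta,C_F)$ for all $z\in\Omega_\beta$. -/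

import Mathlib

/-- The open circular sector `{z : |z| < r, arg z ∈ (-α/2, α/2)}` with vertex at the origin. The
vertex itself is excluded (in Mathlib `Complex.arg 0 = 0`, so this has to be said). -/
def sector (α r : ℝ) : Set ℂ :=
  {z : ℂ | z ≠ 0 ∧ ‖z‖ < r ∧ Complex.arg z ∈ Set.Ioo (-(α / 2)) (α / 2)}

/-- `F` is analytic in the (open) set `Ω` and `|F'(z)| ≤ K / |z|` for all `z ∈ Ω`: membership in
the class `𝓑(Ω)` with constant `K`. -/
structure MemBlochWith (F : ℂ → ℂ) (Ω : Set ℂ) (K : ℝ) : Prop where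
  analytic : DifferentiableOn ℂ F Ω
  deriv_le : ∀ z ∈ Ω, ‖deriv F z‖ ≤ K / ‖z‖

/-- `v` is a harmonic conjugate of `u` in the (open) set `Ω`: both are harmonic in `Ω`, and
`u + i v` is analytic in `Ω`. -/
structure IsHarmonicConjugateOn (u v : ℂ → ℝ) (Ω : Set ℂ) : Prop where
  harmonic_left : InnerProductSpace.HarmonicOnNhd u Ω
  harmonic_right : InnerProductSpace.HarmonicOnNhd v Ω
  analytic : DifferentiableOn ℂ (fun z => (u z : ℂ) + Complex.I * (v z : ℂ)) Ω

/-!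
In the coordinate `w = log z` the hypothesis `|F'(z)| ≤ K / |z|` says that `t ↦ F (exp t)` is
`K`-Lipschitz on the real half-line `t ≤ log (1 / 4)`. Its real part, continued by a constant to the
right, is a `K`-Lipschitz function `f` on `ℝ`. The convolution `G` of `f` with the Gaussian
`√(b / π) * exp (-b * t ^ 2)` is entire, and since the Gaussian has integral `1` on every horizontal
line,
`G (x + i y) - f x = √(b / π) * ∫ s, (f s - f x) * exp (-b * (x + i y - s) ^ 2)`,
which is at most `K * exp (b * y ^ 2) / √(π * b)` in absolute value (`norm_gaussianConv_sub_le`).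

For `y = 0` this bound is at most `ε` once `b` is large in terms of `K` and `ε`, so `Re G` is close
to `f` on the real line. As `f` is real, the same bound with `|y| < π / 2` controls `Im G` in the
strip. Hence `u = Re G (log z)`, with the conjugate `Im G (log z)` shifted by a constant, has both
properties, and `δ = 1 / 4` serves for every `ε`. Only the values of `F` on the positive real axis
enter the construction; this is why the angle `β` can be larger than `α`.
-/

open MeasureTheory

/-! ### Convolution with a Gaussian -/

/-- The convolution of `f : ℝ → ℝ` with the Gaussian density `√(b / π) * exp (-b * t ^ 2)`, evaluated
at a complex point `w`. -/
noncomputable def gaussianConv (b : ℝ) (f : ℝ → ℝ) (w : ℂ) : ℂ :=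
  (√(b / Real.pi) : ℝ) * ∫ s : ℝ, (f s : ℂ) * Complex.exp (-b * (w - s) ^ 2)

lemma norm_cexp_neg_mul_sub_sq (b : ℝ) (w : ℂ) (s : ℝ) :
    ‖Complex.exp (-b * (w - s) ^ 2)‖ = Real.exp (-b * ((w.re - s) ^ 2 - w.im ^ 2)) := by
  rw [Complex.norm_exp]
  congr 1
  simp [pow_two]

lemma integrable_affine_mul_affine_mul_gaussian {b : ℝ} (hb : 0 < b) (p q r t : ℝ) :
    Integrable fun s : ℝ => (p + q * |s|) * (r + t * |s|) * Real.exp (-b * s ^ 2) := by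
  have h0 := integrable_exp_neg_mul_sq hb
  have h1 : Integrable fun s : ℝ => |s| * Real.exp (-b * s ^ 2) := by
    simpa [abs_mul] using (integrable_mul_exp_neg_mul_sq hb).abs
  have h2 : Integrable fun s : ℝ => s ^ 2 * Real.exp (-b * s ^ 2) := by
    simpa using integrable_rpow_mul_exp_neg_mul_sq hb (s := 2) (by norm_num)
  refine (((h0.const_mul (p * r)).add (h1.const_mul (p * t + q * r))).add
    (h2.const_mul (q * t))).congr (Filter.Eventually.of_forall fun s => ?_)
  simp only [Pi.add_apply, ← sq_abs s]
  ring

lemma integral_abs_mul_gaussian {b : ℝ} (hb : 0 < b) :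
    ∫ s : ℝ, |s| * Real.exp (-b * s ^ 2) = 1 / b := by
  have h := integral_comp_abs (f := fun s : ℝ => s * Real.exp (-b * s ^ 2))
  simp only [sq_abs] at h
  have h2 := integral_mul_cexp_neg_mul_sq (b := (b : ℂ)) (by simpa using hb)
  have h3 : ∫ s : ℝ in Set.Ioi 0, s * Real.exp (-b * s ^ 2) = (2 * b)⁻¹ := by
    rw [← Complex.ofReal_inj, ← integral_complex_ofReal]
    push_cast
    exact h2
  rw [h, h3]
  field_simp

lemma integral_cexp_neg_mul_sub_sq {b : ℝ} (hb : 0 < b) (w : ℂ) :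
    ∫ s : ℝ, Complex.exp (-b * (w - s) ^ 2) = (√(Real.pi / b) : ℝ) := by
  have h := GaussianFourier.integral_cexp_neg_mul_sq_add_real_mul_I
    (b := (b : ℂ)) (by simpa using hb) (-w.im)
  rw [← integral_sub_right_eq_self _ w.re] at h
  rw [Real.sqrt_eq_rpow, Complex.ofReal_cpow (by positivity)]
  push_cast
  rw [← h]
  refine integral_congr_ae (Filter.Eventually.of_forall fun s => ?_)
  simp only
  congr 2
  conv_lhs => rw [← Complex.re_add_im w]
  push_cast
  ring

lemma exp_gaussian_le {b R x y s : ℝ} (hb : 0 < b) (hx : |x| ≤ R) (hy : |y| ≤ R) :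
    Real.exp (-b * ((x - s) ^ 2 - y ^ 2)) ≤
      Real.exp (2 * b * R ^ 2) * Real.exp (-(b / 2) * s ^ 2) := by
  rw [← Real.exp_add, Real.exp_le_exp]
  have hx2 := sq_le_sq' (abs_le.mp hx).1 (abs_le.mp hx).2
  have hy2 := sq_le_sq' (abs_le.mp hy).1 (abs_le.mp hy).2
  have key : s ^ 2 / 2 - 2 * R ^ 2 ≤ (x - s) ^ 2 - y ^ 2 := by
    nlinarith [sq_nonneg (2 * x - s)]
  nlinarith [mul_le_mul_of_nonneg_left key hb.le]

section Lipschitz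

variable {f : ℝ → ℝ} {K b : ℝ}

lemma continuous_of_abs_sub_le (hf : ∀ s t, |f s - f t| ≤ K * |s - t|) : Continuous f :=
  (LipschitzWith.of_dist_le' (K := K) fun s t => by simpa [Real.dist_eq] using hf s t).continuous

lemma abs_le_of_abs_sub_le (hf : ∀ s t, |f s - f t| ≤ K * |s - t|) (s : ℝ) :
    |f s| ≤ |f 0| + K * |s| := by
  have h1 := hf s 0
  have h2 := abs_add_le (f s - f 0) (f 0)
  simp only [sub_zero, sub_add_cancel] at h1 h2
  linarith

lemma integrable_mul_cexp_neg_mul_sub_sq (hb : 0 < b)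
    (hf : ∀ s t, |f s - f t| ≤ K * |s - t|) (w : ℂ) :
    Integrable fun s : ℝ => (f s : ℂ) * Complex.exp (-b * (w - s) ^ 2) := by
  have hc := continuous_of_abs_sub_le hf
  refine Integrable.mono' ((integrable_affine_mul_affine_mul_gaussian (half_pos hb)
    (|f 0|) K 1 0).const_mul (Real.exp (2 * b * ‖w‖ ^ 2)))
    (Continuous.aestronglyMeasurable (by fun_prop)) (Filter.Eventually.of_forall fun s => ?_)
  rw [norm_mul, norm_cexp_neg_mul_sub_sq, Complex.norm_real, Real.norm_eq_abs]
  calc _ ≤ (|f 0| + K * |s|) * (Real.exp (2 * b * ‖w‖ ^ 2) * Real.exp (-(b / 2) * s ^ 2)) :=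
        mul_le_mul (abs_le_of_abs_sub_le hf s)
          (exp_gaussian_le hb (Complex.abs_re_le_norm w) (Complex.abs_im_le_norm w))
          (by positivity) ((abs_nonneg _).trans (abs_le_of_abs_sub_le hf s))
    _ = _ := by ring

lemma differentiable_gaussianConv (hb : 0 < b) (hf : ∀ s t, |f s - f t| ≤ K * |s - t|) :
    Differentiable ℂ (gaussianConv b f) := by
  intro w₀
  have hc := continuous_of_abs_sub_le hf
  set R : ℝ := ‖w₀‖ + 1
  refine DifferentiableAt.const_mul (HasDerivAt.differentiableAt
    (hasDerivAt_integral_of_dominated_loc_of_deriv_le (μ := volume)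
      (F := fun (w : ℂ) (s : ℝ) => (f s : ℂ) * Complex.exp (-b * (w - s) ^ 2))
      (F' := fun (w : ℂ) (s : ℝ) =>
        (f s : ℂ) * (Complex.exp (-b * (w - s) ^ 2) * (-b * (2 * (w - s)))))
      (bound := fun s => 2 * b * Real.exp (2 * b * R ^ 2) *
        ((|f 0| + K * |s|) * (R + 1 * |s|) * Real.exp (-(b / 2) * s ^ 2)))
      (Metric.ball_mem_nhds w₀ one_pos) ?_ ?_ ?_ ?_ ?_ ?_).2) _
  · exact Filter.Eventually.of_forall fun w => Continuous.aestronglyMeasurable (by fun_prop)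
  · exact integrable_mul_cexp_neg_mul_sub_sq hb hf w₀
  · exact Continuous.aestronglyMeasurable (by fun_prop)
  · refine Filter.Eventually.of_forall fun s w hw => ?_
    have hwR : ‖w‖ ≤ R := by
      have := norm_sub_norm_le w w₀
      rw [Metric.mem_ball, dist_eq_norm] at hw
      simp only [R]
      linarith
    have h1 := abs_le_of_abs_sub_le hf s
    have h2 : ‖w - s‖ ≤ R + 1 * |s| := by
      have := norm_sub_le w (s : ℂ)
      rw [Complex.norm_real, Real.norm_eq_abs] at this
      linarith
    have h3 := exp_gaussian_le (s := s) hb ((Complex.abs_re_le_norm w).trans hwR)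
      ((Complex.abs_im_le_norm w).trans hwR)
    have h0 : 0 ≤ |f 0| + K * |s| := (abs_nonneg _).trans h1
    have hR : 0 ≤ R + 1 * |s| := (norm_nonneg _).trans h2
    rw [norm_mul, norm_mul, norm_cexp_neg_mul_sub_sq, Complex.norm_real, Real.norm_eq_abs,
      norm_mul, norm_neg, norm_mul, Complex.norm_real, Real.norm_of_nonneg hb.le, Complex.norm_two]
    calc _ ≤ (|f 0| + K * |s|) * ((Real.exp (2 * b * R ^ 2) * Real.exp (-(b / 2) * s ^ 2)) *
          (b * (2 * (R + 1 * |s|)))) := by gcongr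
      _ = _ := by ring
  · exact (integrable_affine_mul_affine_mul_gaussian (half_pos hb) _ _ _ _).const_mul _
  · refine Filter.Eventually.of_forall fun s w _ => ?_
    have h : HasDerivAt (fun w : ℂ => -b * (w - s) ^ 2) (-b * (2 * (w - s))) w := by
      simpa using (((hasDerivAt_id w).sub_const (s : ℂ)).pow 2).const_mul (-b : ℂ)
    exact h.cexp.const_mul _

/-- The Gaussian convolution of a Lipschitz function stays close to the function, also off the real
line. On the real line this is the approximation property; as `f` is real, it also bounds the
imaginary part of `gaussianConv b f` in horizontal strips. -/
lemma norm_gaussianConv_sub_le (hb : 0 < b) (hf : ∀ s t, |f s - f t| ≤ K * |s - t|) (w : ℂ) :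
    ‖gaussianConv b f w - f w.re‖ ≤ K * Real.exp (b * w.im ^ 2) / √(Real.pi * b) := by
  have hpi := Real.pi_pos
  have hconst : Integrable fun s : ℝ => (f w.re : ℂ) * Complex.exp (-b * (w - s) ^ 2) :=
    integrable_mul_cexp_neg_mul_sub_sq (f := fun _ => f w.re) (K := 0) hb (by simp) w
  have hone : ((√(b / Real.pi) : ℝ) : ℂ) * (√(Real.pi / b) : ℝ) = 1 := by
    rw [← Complex.ofReal_mul, ← Real.sqrt_mul (by positivity)]
    have : b / Real.pi * (Real.pi / b) = 1 := by field_simp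
    simp [this]
  have heq : gaussianConv b f w - f w.re = (√(b / Real.pi) : ℝ) *
      ∫ s : ℝ, ((f s - f w.re : ℝ) : ℂ) * Complex.exp (-b * (w - s) ^ 2) := by
    have h : ∫ s : ℝ, ((f s - f w.re : ℝ) : ℂ) * Complex.exp (-b * (w - s) ^ 2) =
        (∫ s : ℝ, (f s : ℂ) * Complex.exp (-b * (w - s) ^ 2)) -
          f w.re * (√(Real.pi / b) : ℝ) := by
      rw [← integral_cexp_neg_mul_sub_sq hb w, ← integral_const_mul,
        ← integral_sub (integrable_mul_cexp_neg_mul_sub_sq hb hf w) hconst]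
      simp only [Complex.ofReal_sub, sub_mul]
    rw [h, gaussianConv]
    linear_combination (f w.re : ℂ) * hone
  have hint : Integrable fun s : ℝ => |s| * Real.exp (-b * s ^ 2) := by
    simpa using integrable_affine_mul_affine_mul_gaussian hb 0 1 1 0
  have hbound : ‖∫ s : ℝ, ((f s - f w.re : ℝ) : ℂ) * Complex.exp (-b * (w - s) ^ 2)‖ ≤
      ∫ s : ℝ, K * Real.exp (b * w.im ^ 2) *
        (|s - w.re| * Real.exp (-b * (s - w.re) ^ 2)) := by
    refine norm_integral_le_of_norm_le ((hint.comp_sub_right w.re).const_mul _)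
      (Filter.Eventually.of_forall fun s => ?_)
    rw [norm_mul, norm_cexp_neg_mul_sub_sq, Complex.norm_real, Real.norm_eq_abs]
    have hexp : Real.exp (-b * ((w.re - s) ^ 2 - w.im ^ 2)) =
        Real.exp (b * w.im ^ 2) * Real.exp (-b * (s - w.re) ^ 2) := by
      rw [← Real.exp_add]
      ring_nf
    rw [hexp]
    calc _ ≤ K * |s - w.re| * (Real.exp (b * w.im ^ 2) * Real.exp (-b * (s - w.re) ^ 2)) :=
          mul_le_mul_of_nonneg_right (hf _ _) (by positivity)
      _ = _ := by ring
  rw [integral_const_mul, integral_sub_right_eq_self (fun s : ℝ => |s| * Real.exp (-b * s ^ 2)),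
    integral_abs_mul_gaussian hb] at hbound
  rw [heq, norm_mul, Complex.norm_real, Real.norm_of_nonneg (Real.sqrt_nonneg _)]
  refine (mul_le_mul_of_nonneg_left hbound (Real.sqrt_nonneg _)).trans (le_of_eq ?_)
  have hsb : √b ^ 2 = b := Real.sq_sqrt hb.le
  have hsb0 : √b ≠ 0 := by positivity
  rw [Real.sqrt_div hb.le, Real.sqrt_mul hpi.le]
  field_simp
  rw [hsb, mul_comm]

end Lipschitz

/-! ### Sectors and the logarithmic coordinate -/

lemma mem_slitPlane_of_mem_sector {β r : ℝ} (hβ : β < Real.pi) {z : ℂ} (hz : z ∈ sector β r) :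
    z ∈ Complex.slitPlane :=
  Complex.mem_slitPlane_iff_arg.mpr ⟨by linarith [hz.2.2.2, Real.pi_pos], hz.1⟩

lemma isOpen_sector {β : ℝ} (hβ : β < Real.pi) (r : ℝ) : IsOpen (sector β r) := by
  rw [isOpen_iff_mem_nhds]
  rintro z ⟨hz, hr, harg⟩
  have hslit := mem_slitPlane_of_mem_sector hβ ⟨hz, hr, harg⟩
  exact Filter.inter_mem (isOpen_ne.mem_nhds hz) (Filter.inter_mem
    ((isOpen_lt continuous_norm continuous_const).mem_nhds hr)
    ((Complex.continuousAt_arg hslit).preimage_mem_nhds (isOpen_Ioo.mem_nhds harg)))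

lemma ofReal_mem_sector {α r x : ℝ} (hα : 0 < α) (hx : 0 < x) (hr : x < r) :
    (x : ℂ) ∈ sector α r := by
  refine ⟨by exact_mod_cast hx.ne', by simpa [abs_of_pos hx] using hr, ?_⟩
  rw [Complex.arg_ofReal_of_nonneg hx.le]
  constructor <;> linarith

/-- In the logarithmic coordinate, the real part of `F` on the positive axis is Lipschitz. The
minimum continues it by a constant beyond `log (1 / 4)`. -/
lemma MemBlochWith.abs_re_exp_sub_le {F : ℂ → ℂ} {α K : ℝ} (hα : 0 < α) (hα' : α < Real.pi)
    (hF : MemBlochWith F (sector α (1 / 2)) K) (s t : ℝ) :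
    |(F (Real.exp (min s (Real.log (1 / 4))))).re - (F (Real.exp (min t (Real.log (1 / 4))))).re| ≤
      K * |s - t| := by
  set a := Real.log (1 / 4)
  have hmem : ∀ r ∈ Set.Iic a, ((Real.exp r : ℝ) : ℂ) ∈ sector α (1 / 2) := fun r hr => by
    refine ofReal_mem_sector hα (Real.exp_pos r) ?_
    have := Real.exp_le_exp.mpr (Set.mem_Iic.mp hr)
    rw [Real.exp_log (by norm_num)] at this
    linarith
  have hderiv : ∀ r ∈ Set.Iic a, HasDerivWithinAt (fun r : ℝ => F (Real.exp r))
      (deriv F (Real.exp r : ℝ) * (Real.exp r : ℝ)) (Set.Iic a) r := fun r hr => by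
    have h1 := (hF.analytic.differentiableAt
      ((isOpen_sector hα' _).mem_nhds (hmem r hr))).hasDerivAt
    exact (h1.comp r (Real.hasDerivAt_exp r).ofReal_comp).hasDerivWithinAt
  have hle : ∀ r ∈ Set.Iic a, ‖deriv F (Real.exp r : ℝ) * (Real.exp r : ℝ)‖ ≤ K := fun r hr => by
    have h := hF.deriv_le _ (hmem r hr)
    rw [Complex.norm_real, Real.norm_of_nonneg (Real.exp_pos r).le] at h
    rw [norm_mul, Complex.norm_real, Real.norm_of_nonneg (Real.exp_pos r).le]
    exact (le_div_iff₀ (Real.exp_pos r)).mp h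
  have hK : 0 ≤ K := (norm_nonneg _).trans (hle a Set.self_mem_Iic)
  have h := (convex_Iic a).norm_image_sub_le_of_norm_hasDerivWithin_le hderiv hle
    (Set.mem_Iic.mpr (min_le_right t a)) (Set.mem_Iic.mpr (min_le_right s a))
  calc _ ≤ _ := by rw [← Complex.sub_re]; exact Complex.abs_re_le_norm _
    _ ≤ _ := h
    _ ≤ _ := by
      gcongr
      simpa using abs_min_sub_min_le_max s a t a

lemma isHarmonicConjugateOn_re_im {G : ℂ → ℂ} {Ω : Set ℂ} (hΩ : IsOpen Ω)
    (hG : DifferentiableOn ℂ G Ω) :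
    IsHarmonicConjugateOn (fun z => (G z).re) (fun z => (G z).im) Ω where
  harmonic_left z hz := (hG.analyticAt (hΩ.mem_nhds hz)).harmonicAt_re
  harmonic_right z hz := (hG.analyticAt (hΩ.mem_nhds hz)).harmonicAt_im
  analytic := hG.congr fun z _ => by rw [mul_comm, Complex.re_add_im]

theorem theorem2 (ε : ℝ) (hε : 0 < ε) :
    ∃ δ : ℝ, 0 < δ ∧ δ < 1 / 2 ∧
      ∀ α β : ℝ, 0 < α → α < β → β < Real.pi → ∀ CF : ℝ,
        ∃ C : ℝ, ∀ F : ℂ → ℂ, MemBlochWith F (sector α (1 / 2)) CF →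
          ∃ u : ℂ → ℝ, InnerProductSpace.HarmonicOnNhd u (sector β 1) ∧
            (∀ x : ℝ, x ∈ Set.Ioc 0 δ → |u (x : ℂ) - (F (x : ℂ)).re| ≤ ε) ∧
            ∃ v : ℂ → ℝ, IsHarmonicConjugateOn u v (sector β 1) ∧ v (1 / 2) = 0 ∧
              ∀ z ∈ sector β 1, |v z| ≤ C := by
  refine ⟨1 / 4, by norm_num, by norm_num, fun α β hα hαβ hβ CF => ?_⟩
  -- With this choice `CF / √(π * b) ≤ ε`.
  set b : ℝ := (CF / ε) ^ 2 + 1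
  have hb : 0 < b := by positivity
  have hπ := Real.pi_pos
  refine ⟨2 * (CF * Real.exp (b * (β / 2) ^ 2) / √(Real.pi * b)), fun F hF => ?_⟩
  set f : ℝ → ℝ := fun s => (F (Real.exp (min s (Real.log (1 / 4))))).re
  have hf : ∀ s t, |f s - f t| ≤ CF * |s - t| :=
    fun s t => hF.abs_re_exp_sub_le hα (hαβ.trans hβ) s t
  have hCF : 0 ≤ CF := by simpa using (abs_nonneg _).trans (hf 1 0)
  have hsmall : CF / √(Real.pi * b) ≤ ε := by
    rw [div_le_iff₀ (by positivity), ← div_le_iff₀' hε]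
    refine Real.le_sqrt_of_sq_le ?_
    nlinarith [Real.pi_gt_three]
  -- The shift by an imaginary constant normalizes the conjugate at `1 / 2`.
  set c : ℝ := (gaussianConv b f (Complex.log (1 / 2))).im with hc
  set G : ℂ → ℂ := fun z => gaussianConv b f (Complex.log z) - Complex.I * c
  have hG : DifferentiableOn ℂ G (sector β 1) := fun z hz =>
    (((differentiable_gaussianConv hb hf _).comp z
      (Complex.differentiableAt_log (mem_slitPlane_of_mem_sector hβ hz))).sub_const
        _).differentiableWithinAt
  have hconj := isHarmonicConjugateOn_re_im (isOpen_sector hβ 1) hG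
  have him : ∀ z ∈ sector β 1, |(gaussianConv b f (Complex.log z)).im| ≤
      CF * Real.exp (b * (β / 2) ^ 2) / √(Real.pi * b) := fun z hz => by
    have h := norm_gaussianConv_sub_le hb hf (Complex.log z)
    have h' := Complex.abs_im_le_norm
      (gaussianConv b f (Complex.log z) - f (Complex.log z).re)
    rw [Complex.sub_im, Complex.ofReal_im, sub_zero] at h'
    refine (h'.trans h).trans ?_
    rw [Complex.log_im]
    have harg := sq_le_sq' hz.2.2.1.le hz.2.2.2.le
    gcongr
  refine ⟨_, hconj.harmonic_left, fun x hx => ?_, _, hconj, ?_, fun z hz => ?_⟩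
  · have hx0 : 0 < x := hx.1
    have hlog : Complex.log x = (Real.log x : ℝ) := (Complex.ofReal_log hx0.le).symm
    have hfx : f (Real.log x) = (F x).re := by
      simp only [f]
      rw [min_eq_left (Real.log_le_log hx0 hx.2), Real.exp_log hx0]
    have h := norm_gaussianConv_sub_le hb hf (Complex.log x)
    have h' := Complex.abs_re_le_norm
      (gaussianConv b f (Complex.log x) - f (Complex.log x).re)
    rw [hlog] at h h'
    simp only [Complex.ofReal_re, Complex.ofReal_im, hfx, Complex.sub_re] at h h'
    simp only [G, hlog]
    simpa using h'.trans (h.trans (by simpa using hsmall))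
  · simp [G, hc]
  · have hhalf : (1 / 2 : ℂ) ∈ sector β 1 := by
      simpa using ofReal_mem_sector (x := 1 / 2) (hα.trans hαβ) (by norm_num) (by norm_num)
    have h1 := him z hz
    have h2 := him _ hhalf
    have h3 := abs_sub (gaussianConv b f (Complex.log z)).im c
    simp only [G, Complex.sub_im, Complex.mul_im, Complex.I_re, Complex.I_im, Complex.ofReal_re,
      Complex.ofReal_im, zero_mul, one_mul, zero_add]
    linarith
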